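/- Let $R$ be a complete discrete valuation ring with quotient field $K$ and maximal ideal $P=\pi R$, and let $\Lambda=(P^{\alpha_{ij}})_n\subseteq M_n(K)$ be a tiled order with exponent matrix $(\alpha_{ij})$, i.e. the $\alpha_{ij}$ are non-negative integers with $\alpha_{ii}=0$ and $\alpha_{ij}+\alpha_{jk}\ge\alpha_{ik}$ for all $i,j,k$. Assume that $\Lambda$ is basic, i.e. $\alpha_{ij}+\alpha_{ji}>0$ for $i\ne j$. Let $M_k$ be obtained from $\Lambda$ by replacing the $R$ in position $(k,k)$ by $P$; then $M_1,\dots,M_n$ are the distinct maximal two-sided ideals of $\Lambda$. The link graph $Q(\Lambda)$ is the quiver with vertices $1,\dots,n$ and an arrow from $i$ to $j$ if and only if $M_jM_i\ne M_j\cap M_i$; its automorphisms are identified with permutations of $\{1,\dots,n\}$. Call $\sigma\in\operatorname{Aut}(Q(\Lambda))$ liftable if there is $\varphi\in\operatorname{Aut}_R(\Lambda)$ with $\varphi(M_i)=M_{\sigma(i)}$ for all $i$. For $g\in GL_n(K)$ let $\iota_g$ denote the conjugation $y\mapsto g^{-1}yg$; write $\iota_g\in\operatorname{Aut}_R(\Lambda)$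 if $\iota_g$ restricts to an $R$-automorphism of $\Lambda$. Let $v(\sigma)$ be the permutation matrix with $v(\sigma)_{ij}=1$ if $j=\sigma(i)$ and $0$ otherwise, and $d(\mathbf x)=\operatorname{diag}(\pi^{x_1},\dots,\pi^{x_n})$ for $\mathbf x\in\mathbb Z^n$. For a permutation $\sigma$ consider the linear system $$x_i-x_j=\alpha_{ij}-\alpha_{\sigma(i)\sigma(j)}\qquad (1\le i,j\le n).\tag{1}$$ (a) $\sigma\in\operatorname{Aut}(Q(\Lambda))$ is liftable if and only if (1) has a solution $\mathbf x\in\mathbb Z^n$. (b) If $\sigma\in\operatorname{Aut}(Q(\Lambda))$ is liftable and $\mathbf x\in\mathbb Z^n$ satisfies the equations of (1) with $i<j$ (in particular, if $\mathbf x$ solves (1)), then $\iota_{d(\mathbf x)v(\sigma)}\in\operatorname{Aut}_R(\Lambda)$. (c) If $\varphi\in\operatorname{Aut}_R(\Lambda)$ is written as $\varphi=\iota_{u\,d\,v(\sigma)}$ with $u\in\Lambda^*$, $d=\operatorname{diag}(\pi^{d_1},\dots,\pi^{d_n})$, $d_i\in\mathbb Z$, and $\sigma\in S_n$, then $(d_1,\dots,d_n)$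 is a solution of (1). (d) The set $\mathcal O_\Lambda=\{\iota_{d(\mathbf x)v(\sigma)} : \sigma\in\operatorname{Aut}(Q(\Lambda))\text{ liftable},\ \mathbf x\in\mathbb Z^n\text{ a solution of (1)}\}$ is a subgroup of $\operatorname{Aut}_R(\Lambda)$, and $\operatorname{Aut}_R(\Lambda)=\operatorname{Inn}(\Lambda)\rtimes\mathcal O_\Lambda$ (internal semidirect product with $\operatorname{Inn}(\Lambda)$ normal). -/

import Mathlib

namespace TiledOrder

/-- An exponent matrix: nonnegative integers `α i j` with `α i i = 0` and
`α i k ≤ α i j + α j k`. -/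
structure ExponentMatrix (n : ℕ) where
  exp : Fin n → Fin n → ℕ
  diag : ∀ i, exp i i = 0
  triangle : ∀ i j k, exp i k ≤ exp i j + exp j k

section
variable (R K : Type*) [CommRing R] [IsLocalRing R] [Field K] [Algebra R K] {n : ℕ}

/-- `P ^ a`, viewed inside `K`, where `P` is the maximal ideal of `R`. -/
def primePow (a : ℕ) : Submodule R K :=
  Submodule.map (Algebra.linearMap R K) (IsLocalRing.maximalIdeal R ^ a)

/-- The `R`-lattice `(P ^ β i j)` of matrices whose `(i, j)` entry lies in `P ^ β i j`. -/
def entrywise (β : Fin n → Fin n → ℕ) : Submodule R (Matrix (Fin n) (Fin n) K) where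
  carrier := {A | ∀ i j, A i j ∈ primePow R K (β i j)}
  add_mem' hA hB i j := add_mem (hA i j) (hB i j)
  zero_mem' _ _ := zero_mem _
  smul_mem' r _ hA i j := Submodule.smul_mem _ r (hA i j)

variable {R K} in
theorem primePow_mul_mem {a b c : ℕ} (h : c ≤ a + b) {x y : K} (hx : x ∈ primePow R K a)
    (hy : y ∈ primePow R K b) : x * y ∈ primePow R K c := by
  obtain ⟨r, hr, rfl⟩ := hx
  obtain ⟨s, hs, rfl⟩ := hy
  refine ⟨r * s, Ideal.pow_le_pow_right h ?_, by simp⟩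
  rw [pow_add]
  exact Ideal.mul_mem_mul hr hs

/-- The tiled order `Λ = (P ^ α i j)` in `M_n(K)` with exponent matrix `α`. -/
def order (α : ExponentMatrix n) : Subalgebra R (Matrix (Fin n) (Fin n) K) where
  carrier := {A | ∀ i j, A i j ∈ primePow R K (α.exp i j)}
  add_mem' hA hB i j := add_mem (hA i j) (hB i j)
  mul_mem' {A B} hA hB i j := by
    rw [Matrix.mul_apply]
    exact sum_mem fun k _ => primePow_mul_mem (α.triangle i k j) (hA i k) (hB k j)
  algebraMap_mem' r i j := by
    rw [Matrix.algebraMap_matrix_apply]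
    split_ifs with h
    · subst h
      exact ⟨r, by simp [α.diag], rfl⟩
    · exact zero_mem _

/-- `M_k`: the order with the `R` in position `(k, k)` replaced by `P`. -/
def maxIdeal (α : ExponentMatrix n) (k : Fin n) : Submodule R (Matrix (Fin n) (Fin n) K) :=
  entrywise R K fun i j => if i = k ∧ j = k then 1 else α.exp i j

/-- Arrows of the link graph: `i → j` iff `M_j M_i ≠ M_j ∩ M_i`. The product is the additive span
of the products `a * b`. -/
def LinkArrow (α : ExponentMatrix n) (i j : Fin n) : Prop :=
  maxIdeal R K α j * maxIdeal R K α i ≠ maxIdeal R K α j ⊓ maxIdeal R K α i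

/-- `Aut(Q(Λ))`: permutations of the vertices of the link graph that preserve and reflect arrows
(there is at most one arrow from `i` to `j`). -/
abbrev LinkAut (α : ExponentMatrix n) : Type := LinkArrow R K α ≃r LinkArrow R K α

/-- `Aut_R(Λ)`. -/
abbrev Aut (α : ExponentMatrix n) : Type _ := order R K α ≃ₐ[R] order R K α

/-- `Inn(Λ)`: the automorphisms given by conjugation with units of `Λ`. -/
def inn (α : ExponentMatrix n) : Subgroup (Aut R K α) :=
  (MulSemiringAction.toAlgAut (ConjAct (order R K α)ˣ) R (order R K α)).range

variable {R K}

/-- `φ` induces the permutation `σ` on the maximal ideals: `φ(M_i) = M_{σ(i)}` for all `i`. -/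
def Induces {α : ExponentMatrix n} (φ : Aut R K α) (σ : Equiv.Perm (Fin n)) : Prop :=
  ∀ i, ∀ a : order R K α,
    (φ a : Matrix (Fin n) (Fin n) K) ∈ maxIdeal R K α (σ i) ↔
      (a : Matrix (Fin n) (Fin n) K) ∈ maxIdeal R K α i

/-- An automorphism of the link graph is liftable if it is induced by some `φ ∈ Aut_R(Λ)`. -/
def Liftable {α : ExponentMatrix n} (σ : LinkAut R K α) : Prop :=
  ∃ φ : Aut R K α, Induces φ σ.toEquiv

/-- `φ = ι_g` on `Λ`, where `g ∈ GL_n(K)` and `ι_g(y) = g⁻¹ y g`. -/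
def IsConjBy {α : ExponentMatrix n} (φ : Aut R K α) (g : Matrix (Fin n) (Fin n) K) : Prop :=
  IsUnit g ∧ ∀ a : order R K α, (φ a : Matrix (Fin n) (Fin n) K) = g⁻¹ * a * g

variable (K) in
/-- `d(x) = diag(π ^ x_1, …, π ^ x_n)`. -/
def diagPow (ϖ : R) (x : Fin n → ℤ) : Matrix (Fin n) (Fin n) K :=
  Matrix.diagonal fun i => algebraMap R K ϖ ^ x i

end

/-- The linear system `x_i - x_j = α_{ij} - α_{σ(i)σ(j)}`, for all `i` and `j`. -/
def Solves {n : ℕ} (α : ExponentMatrix n) (σ : Equiv.Perm (Fin n)) (x : Fin n → ℤ) : Prop :=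
  ∀ i j, x i - x j = (α.exp i j : ℤ) - (α.exp (σ i) (σ j) : ℤ)

/-- The order is basic: `α i j + α j i > 0` for `i ≠ j`, i.e. its columns are pairwise
non-isomorphic, so that `M_1, …, M_n` are distinct maximal two-sided ideals. -/
def ExponentMatrix.IsBasic {n : ℕ} (α : ExponentMatrix n) : Prop :=
  ∀ i j, i ≠ j → 0 < α.exp i j + α.exp j i

/-- The set `O_Λ = {ι_{d(x)v(σ)} : σ liftable, x a solution of the system for σ}`, where `v(σ)` is
the permutation matrix whose `(i, j)` entry is `1` if `j = σ(i)` and `0` otherwise. -/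
def liftSet {R : Type*} (K : Type*) [CommRing R] [IsLocalRing R] [Field K] [Algebra R K] {n : ℕ}
    (ϖ : R) (α : ExponentMatrix n) : Set (Aut R K α) :=
  {φ | ∃ σ : LinkAut R K α, Liftable σ ∧ ∃ x : Fin n → ℤ, Solves α σ.toEquiv x ∧
    IsConjBy φ (diagPow K ϖ x * Equiv.Perm.permMatrix K σ.toEquiv)}

end TiledOrder

open TiledOrder

namespace TiledOrder

/-! ### Powers of the maximal ideal inside the field. -/

section PrimePow

variable {R K : Type*} [CommRing R] [IsLocalRing R] [Field K] [Algebra R K]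

/-! Every automorphism is an inner one times a monomial one, and a monomial one restricts to `Λ`
exactly when its exponents solve the linear system.

Basicness makes each diagonal entry modulo `P` a ring homomorphism `Λ → R/P` with kernel `M_k`, and
an element with no zero residue is a unit (`isUnit_of_diagResidue_ne_zero`). Hence the images
`φ(e_i)` are conjugate, by one unit of `Λ`, to a permutation of the `e_i`
(`exists_unit_conj_idempotents`). After this correction `φ` moves position `(i, j)` to `(σ i, σ j)`
and scales it by a factor `h i j`; multiplicativity makes `h` a cocycle, so `h i j = (c i)⁻¹ * c j`.
The unit parts of the `c i` are absorbed by a diagonal unit of `Λ`, leaving powers of `ϖ`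
(`exists_inn_mul_scalesBy`).

Comparing exponents for the monomial factor and its inverse gives the system (`solves_of_scalesBy`).
Inner automorphisms fix every `M_k`, since `R/P` is commutative, so the monomial factor alone
determines the permutation. This yields (a), (c) and the semidirect decomposition. -/

theorem primePow_anti {a b : ℕ} (h : a ≤ b) {x : K} (hx : x ∈ primePow R K b) :
    x ∈ primePow R K a := by
  obtain ⟨r, hr, rfl⟩ := hx
  exact ⟨r, Ideal.pow_le_pow_right h hr, rfl⟩

theorem mem_primePow_zero {x : K} : x ∈ primePow R K 0 ↔ ∃ r, algebraMap R K r = x := by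
  simp [primePow]

theorem algebraMap_mem_primePow_one [FaithfulSMul R K] {r : R} :
    algebraMap R K r ∈ primePow R K 1 ↔ r ∈ IsLocalRing.maximalIdeal R := by
  constructor
  · rintro ⟨s, hs, h⟩
    rw [pow_one] at hs
    exact FaithfulSMul.algebraMap_injective R K h ▸ hs
  · exact fun h => ⟨r, by simpa using h, rfl⟩

theorem mem_primePow_of_mul_mem [FaithfulSMul R K] {a x : K} {m : ℕ}
    (ha : a ∈ primePow R K 0) (ha' : a ∉ primePow R K 1) (h : a * x ∈ primePow R K m) :
    x ∈ primePow R K m := by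
  obtain ⟨r, rfl⟩ := mem_primePow_zero.1 ha
  have hr : IsUnit r := by
    by_contra hr
    exact ha' (algebraMap_mem_primePow_one.2 hr)
  obtain ⟨u, rfl⟩ := hr
  have := Submodule.smul_mem _ (↑u⁻¹ : R) h
  rwa [Algebra.smul_def, ← mul_assoc, ← map_mul, Units.inv_mul, map_one, one_mul] at this

end PrimePow

theorem algebraMap_irreducible_ne_zero {R K : Type*} [CommRing R] [Field K] [Algebra R K]
    [FaithfulSMul R K] {ϖ : R} (hϖ : Irreducible ϖ) : algebraMap R K ϖ ≠ 0 := by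
  simpa using hϖ.ne_zero

/-! ### Valuations of elements of the fraction field. -/

section DVR

variable {R K : Type*} [CommRing R] [IsDomain R] [IsDiscreteValuationRing R] [Field K]
  [Algebra R K] {ϖ : R}

theorem mem_primePow_iff (hϖ : Irreducible ϖ) {a : ℕ} {x : K} :
    x ∈ primePow R K a ↔ ∃ r : R, x = algebraMap R K ϖ ^ a * algebraMap R K r := by
  unfold primePow
  rw [hϖ.maximalIdeal_eq, Ideal.span_singleton_pow]
  constructor
  · rintro ⟨r, hr, rfl⟩
    obtain ⟨s, rfl⟩ := Ideal.mem_span_singleton.1 hr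
    exact ⟨s, by simp⟩
  · rintro ⟨r, rfl⟩
    exact ⟨ϖ ^ a * r, Ideal.mem_span_singleton.2 (dvd_mul_right _ _), by simp⟩

variable [IsFractionRing R K]

theorem pow_mul_mem_primePow_iff (hϖ : Irreducible ϖ) {a b : ℕ} {x : K} :
    algebraMap R K ϖ ^ b * x ∈ primePow R K (a + b) ↔ x ∈ primePow R K a := by
  have h0 := algebraMap_irreducible_ne_zero (K := K) hϖ
  simp only [mem_primePow_iff hϖ, pow_add]
  refine exists_congr fun r => ?_
  rw [mul_comm (_ ^ a), mul_assoc, mul_right_inj' (pow_ne_zero _ h0)]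

theorem exists_eq_zpow_mul_unit (hϖ : Irreducible ϖ) {x : K} (hx : x ≠ 0) :
    ∃ (z : ℤ) (u : Rˣ), x = algebraMap R K ϖ ^ z * algebraMap R K u := by
  obtain ⟨z, u, h⟩ :=
    IsDiscreteValuationRing.exists_units_eq_smul_zpow_of_irreducible hϖ hx
  exact ⟨z, u, by rw [h, Units.smul_def, Algebra.smul_def, mul_comm]⟩

theorem zpow_mem_primePow_iff (hϖ : Irreducible ϖ) {a : ℕ} {z : ℤ} :
    algebraMap R K ϖ ^ z ∈ primePow R K a ↔ (a : ℤ) ≤ z := by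
  have h0 := algebraMap_irreducible_ne_zero (K := K) hϖ
  rw [mem_primePow_iff hϖ]
  constructor
  · rintro ⟨r, hr⟩
    by_contra! hlt
    -- The `- 1` keeps one factor `ϖ` apart, so that cancelling `ϖ ^ z` exhibits `ϖ` as a divisor of
    -- `1`.
    obtain ⟨m, hm⟩ := Int.eq_ofNat_of_zero_le (show 0 ≤ (a : ℤ) - z - 1 by omega)
    have : (1 : K) = algebraMap R K (ϖ * (ϖ ^ m * r)) := by
      rw [map_mul, map_mul, map_pow]
      have e : algebraMap R K ϖ ^ z * 1 =
          algebraMap R K ϖ ^ z * (algebraMap R K ϖ * (algebraMap R K ϖ ^ m * algebraMap R K r)) :=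
        calc algebraMap R K ϖ ^ z * 1 = algebraMap R K ϖ ^ a * algebraMap R K r := by
              rw [mul_one, hr]
          _ = algebraMap R K ϖ ^ (z + ((m + 1 : ℕ) : ℤ)) * algebraMap R K r := by
              rw [← zpow_natCast]
              congr 2
              push_cast
              omega
          _ = _ := by
              rw [zpow_add₀ h0, zpow_natCast]
              ring
      exact mul_left_cancel₀ (zpow_ne_zero _ h0) e
    rw [← map_one (algebraMap R K)] at this
    exact hϖ.not_isUnit (IsUnit.of_mul_eq_one _ (IsFractionRing.injective R K this).symm)
  · intro h
    obtain ⟨m, hm⟩ := Int.eq_ofNat_of_zero_le (sub_nonneg.2 h)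
    refine ⟨ϖ ^ m, ?_⟩
    rw [map_pow, ← pow_add, ← zpow_natCast]
    congr 1
    push_cast
    omega

theorem exists_pow_mul_mem_primePow (hϖ : Irreducible ϖ) (a : ℕ) (x : K) :
    ∃ m : ℕ, algebraMap R K ϖ ^ m * x ∈ primePow R K a := by
  by_cases hx : x = 0
  · exact ⟨0, by simp [hx]⟩
  have h0 := algebraMap_irreducible_ne_zero (K := K) hϖ
  obtain ⟨z, u, rfl⟩ := exists_eq_zpow_mul_unit hϖ hx
  refine ⟨((a : ℤ) - z).toNat, ?_⟩
  rw [← mul_assoc, ← zpow_natCast, ← zpow_add₀ h0]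
  refine primePow_mul_mem (a := a) (b := 0) le_rfl ((zpow_mem_primePow_iff hϖ).2 ?_)
    (mem_primePow_zero.2 ⟨_, rfl⟩)
  omega

theorem eq_zero_of_forall_zpow_mul_mem (hϖ : Irreducible ϖ) {x : K}
    (h : ∀ z : ℤ, algebraMap R K ϖ ^ z * x ∈ primePow R K 0) : x = 0 := by
  by_contra hx
  have h0 := algebraMap_irreducible_ne_zero (K := K) hϖ
  obtain ⟨z, u, rfl⟩ := exists_eq_zpow_mul_unit hϖ hx
  have := h (-1 - z)
  rw [← mul_assoc, ← zpow_add₀ h0] at this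
  have := primePow_mul_mem (a := 0) (b := 0) le_rfl this
    (mem_primePow_zero.2 ⟨(↑u⁻¹ : R), rfl⟩)
  rw [mul_assoc, ← map_mul, Units.mul_inv, map_one, mul_one, zpow_mem_primePow_iff hϖ] at this
  omega

end DVR

/-! ### Elements of the order with unit diagonal are units. -/

section UnitCriterion

variable {R K : Type*} [CommRing R] [IsDomain R] [IsDiscreteValuationRing R] [Field K]
  [Algebra R K] [IsFractionRing R K] {ϖ : R} {n : ℕ} {α : ExponentMatrix n}

/-- Tight triangle inequalities compose, which gives transitivity; a cycle `i, k, i` would force `α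
i k + α k i = 0`, against basicness. This is the order for the induction on rows below. -/
theorem ExponentMatrix.wellFounded_tight (hα : α.IsBasic) (j : Fin n) :
    WellFounded fun k i : Fin n => k ≠ i ∧ α.exp i k + α.exp k j = α.exp i j := by
  have : IsTrans (Fin n) fun k i : Fin n => k ≠ i ∧ α.exp i k + α.exp k j = α.exp i j := by
    refine ⟨fun l k i h1 h2 => ?_⟩
    obtain ⟨h1, e1⟩ := h1
    obtain ⟨h2, e2⟩ := h2
    have t1 := α.triangle i l j
    have t2 := α.triangle i k l
    refine ⟨?_, by omega⟩
    rintro rfl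
    have := hα _ _ h1
    omega
  have : Std.Irrefl fun k i : Fin n => k ≠ i ∧ α.exp i k + α.exp k j = α.exp i j :=
    ⟨fun i h => h.1 rfl⟩
  exact Finite.wellFounded_of_trans_of_irrefl _

/-- In the sum for `(A * B) i j`, a term with `k ≠ i` gains a power of `P` either from a strict
triangle inequality or, when it is tight, from the induction hypothesis on row `k`. What remains is
`A i i * B i j`, and `A i i` is a unit of `R`. -/
theorem mem_primePow_succ_of_mul_mem (hα : α.IsBasic) {A B : Matrix (Fin n) (Fin n) K}
    (hA : A ∈ order R K α) (hA' : ∀ k, A k k ∉ primePow R K 1) (hB : B ∈ order R K α)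
    (hAB : ∀ i j, (A * B) i j ∈ primePow R K (α.exp i j + 1)) (i j : Fin n) :
    B i j ∈ primePow R K (α.exp i j + 1) := by
  induction i using (ExponentMatrix.wellFounded_tight hα j).induction with
  | _ i ih =>
    have h := hAB i j
    rw [Matrix.mul_apply, ← Finset.add_sum_erase _ _ (Finset.mem_univ i)] at h
    have hs : ∑ k ∈ Finset.univ.erase i, A i k * B k j ∈ primePow R K (α.exp i j + 1) := by
      refine sum_mem fun k hk => ?_
      have hki := (Finset.mem_erase.1 hk).1
      have ht := α.triangle i k j
      by_cases he : α.exp i k + α.exp k j = α.exp i j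
      · exact primePow_mul_mem (by omega) (hA i k) (ih k ⟨hki, he⟩)
      · exact primePow_mul_mem (by omega) (hA i k) (hB k j)
    refine mem_primePow_of_mul_mem ?_ (hA' i) ((Submodule.add_mem_iff_left _ hs).1 h)
    simpa [α.diag] using hA i i

theorem mem_order_of_mul_mem (hϖ : Irreducible ϖ) (hα : α.IsBasic)
    {A B : Matrix (Fin n) (Fin n) K} (hA : A ∈ order R K α)
    (hA' : ∀ k, A k k ∉ primePow R K 1) (hAB : A * B ∈ order R K α) : B ∈ order R K α := by
  -- Some power of `ϖ` brings `B` into the order; the previous lemma strips these factors one at a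
  -- time.
  have key : ∀ m : ℕ, algebraMap R K ϖ ^ m • B ∈ order R K α → B ∈ order R K α := by
    intro m
    induction m with
    | zero => simp
    | succ m ih =>
      intro hm
      refine ih fun i j => (pow_mul_mem_primePow_iff (b := 1) hϖ).1 ?_
      have := mem_primePow_succ_of_mul_mem hα hA hA' hm (fun i j => ?_) i j
      · simpa [pow_succ', mul_assoc] using this
      · rw [Matrix.mul_smul, pow_succ, Matrix.smul_apply, smul_eq_mul, mul_assoc]
        refine primePow_mul_mem (a := 0) (by rw [zero_add])
          (mem_primePow_zero.2 ⟨ϖ ^ m, by simp⟩) ?_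
        simpa using (pow_mul_mem_primePow_iff (b := 1) hϖ).2 (hAB i j)
  choose m hm using fun p : Fin n × Fin n =>
    exists_pow_mul_mem_primePow hϖ (α.exp p.1 p.2) (B p.1 p.2)
  refine key (∑ p, m p) fun i j => ?_
  rw [← Finset.sum_erase_add _ _ (Finset.mem_univ (i, j)), pow_add, Matrix.smul_apply,
    smul_eq_mul, mul_assoc]
  exact primePow_mul_mem (a := 0) (by rw [zero_add])
    (mem_primePow_zero.2 ⟨ϖ ^ _, by rw [map_pow]⟩) (hm (i, j))

theorem isUnit_of_diag_notMem (hϖ : Irreducible ϖ) (hα : α.IsBasic) {a : order R K α}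
    (ha : ∀ k, (a : Matrix (Fin n) (Fin n) K) k k ∉ primePow R K 1) : IsUnit a := by
  obtain ⟨A, hA⟩ := a
  have hdet : A.det ≠ 0 := by
    intro hdet
    obtain ⟨v, hv, hAv⟩ := Matrix.exists_mulVec_eq_zero_iff.2 hdet
    refine hv (funext fun i => eq_zero_of_forall_zpow_mul_mem hϖ fun z => ?_)
    -- The matrix whose columns all equal `ϖ ^ z * v` is killed by `A`, hence lies in the order for
    -- every `z`; bounded denominators force `v = 0`.
    have := mem_order_of_mul_mem (B := Matrix.of fun k _ => algebraMap R K ϖ ^ z * v k) hϖ hα hA ha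
      (by
        convert zero_mem (order R K α)
        ext k l
        have := congrFun hAv k
        simp only [Matrix.mulVec, dotProduct, Pi.zero_apply] at this
        simp only [Matrix.mul_apply, Matrix.of_apply, Matrix.zero_apply]
        rw [← mul_zero (algebraMap R K ϖ ^ z), ← this, Finset.mul_sum]
        exact Finset.sum_congr rfl fun _ _ => by ring)
    exact primePow_anti (Nat.zero_le _) (this i i)
  have hu : IsUnit A.det := hdet.isUnit
  have h1 : A * A⁻¹ = 1 := Matrix.mul_nonsing_inv _ hu
  refine ⟨⟨⟨A, hA⟩, ⟨A⁻¹, mem_order_of_mul_mem hϖ hα hA ha (h1 ▸ one_mem _)⟩,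
    Subtype.ext h1, Subtype.ext (Matrix.nonsing_inv_mul _ hu)⟩, rfl⟩

end UnitCriterion
-- Diagonal residues and the ideals `M_k`.
section DiagResidue

variable {R K : Type*} [CommRing R] [IsLocalRing R] [Field K] [Algebra R K]
  {n : ℕ} {α : ExponentMatrix n}

theorem exists_algebraMap_eq_diag (a : order R K α) (k : Fin n) :
    ∃ r, algebraMap R K r = (a : Matrix (Fin n) (Fin n) K) k k :=
  mem_primePow_zero.1 (primePow_anti (Nat.zero_le _) (a.2 k k))

/-- The `(k, k)` entry of an element of the order, as an element of `R`. -/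
noncomputable def diagEntry (k : Fin n) (a : order R K α) : R :=
  (exists_algebraMap_eq_diag a k).choose

theorem algebraMap_diagEntry (k : Fin n) (a : order R K α) :
    algebraMap R K (diagEntry k a) = (a : Matrix (Fin n) (Fin n) K) k k :=
  (exists_algebraMap_eq_diag a k).choose_spec

/-- The cross terms `a k l * b l k` lie in `P ^ (α k l + α l k)`, whose exponent is positive by
basicness. -/
theorem mul_diag_sub_mem (hα : α.IsBasic) (a b : order R K α) (k : Fin n) :
    (a * b : Matrix (Fin n) (Fin n) K) k k -
      (a : Matrix (Fin n) (Fin n) K) k k * (b : Matrix (Fin n) (Fin n) K) k k ∈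
        primePow R K 1 := by
  rw [Matrix.mul_apply, ← Finset.add_sum_erase _ _ (Finset.mem_univ k), add_sub_cancel_left]
  exact sum_mem fun l hl =>
    primePow_mul_mem (hα k l (Finset.ne_of_mem_erase hl).symm) (a.2 k l) (b.2 l k)

variable [FaithfulSMul R K]

/-- The ring homomorphism `Λ → R / P` that sends a matrix to its `(k, k)` entry modulo `P`. -/
noncomputable def diagResidue (hα : α.IsBasic) (k : Fin n) :
    order R K α →+* IsLocalRing.ResidueField R where
  toFun a := IsLocalRing.residue R (diagEntry k a)
  map_one' := by
    rw [← map_one (IsLocalRing.residue R)]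
    congr 1
    apply FaithfulSMul.algebraMap_injective R K
    simp [algebraMap_diagEntry]
  map_zero' := by
    rw [← map_zero (IsLocalRing.residue R)]
    congr 1
    apply FaithfulSMul.algebraMap_injective R K
    simp [algebraMap_diagEntry]
  map_add' a b := by
    rw [← map_add]
    congr 1
    apply FaithfulSMul.algebraMap_injective R K
    simp [algebraMap_diagEntry]
  map_mul' a b := by
    rw [← map_mul, ← sub_eq_zero, ← map_sub, IsLocalRing.residue_eq_zero_iff,
      ← algebraMap_mem_primePow_one (K := K)]
    simpa [algebraMap_diagEntry] using mul_diag_sub_mem hα a b k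

theorem diagResidue_eq_zero_iff (hα : α.IsBasic) (k : Fin n) (a : order R K α) :
    diagResidue hα k a = 0 ↔ (a : Matrix (Fin n) (Fin n) K) k k ∈ primePow R K 1 := by
  rw [← algebraMap_diagEntry, algebraMap_mem_primePow_one, ← IsLocalRing.residue_eq_zero_iff]
  rfl

theorem mem_maxIdeal_iff (hα : α.IsBasic) (k : Fin n) (a : order R K α) :
    (a : Matrix (Fin n) (Fin n) K) ∈ maxIdeal R K α k ↔ diagResidue hα k a = 0 := by
  rw [diagResidue_eq_zero_iff]
  constructor
  · intro h
    simpa using h k k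
  · intro h i j
    by_cases hij : i = k ∧ j = k
    · obtain ⟨rfl, rfl⟩ := hij
      simpa using h
    · simpa [hij] using a.2 i j

end DiagResidue

section Idempotents

variable {R K : Type*} [CommRing R] [IsLocalRing R] [Field K] [Algebra R K]
  {n : ℕ} (α : ExponentMatrix n)

/-- The matrix with the single entry `x ∈ P ^ α i j` in position `(i, j)`. -/
def orderSingle (i j : Fin n) (x : primePow R K (α.exp i j)) : order R K α :=
  ⟨Matrix.single i j (x : K), fun k l => by
    by_cases h : i = k ∧ j = l
    · obtain ⟨rfl, rfl⟩ := h
      simp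
    · rw [Matrix.single_apply, if_neg h]
      exact zero_mem _⟩

variable (R K) in
/-- The diagonal idempotent `e_i` of the order. -/
def diagIdem (i : Fin n) : order R K α :=
  orderSingle α i i ⟨1, by simpa [α.diag] using mem_primePow_zero.2 ⟨1, map_one _⟩⟩

variable {α}

@[simp]
theorem coe_diagIdem (i : Fin n) :
    (diagIdem R K α i : Matrix (Fin n) (Fin n) K) = Matrix.single i i 1 := rfl

variable (R K α) in
theorem completeOrthogonalIdempotents_diagIdem :
    CompleteOrthogonalIdempotents (diagIdem R K α) where
  idem i := Subtype.ext (by simp)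
  ortho i j h := Subtype.ext (by simp [Matrix.single_mul_single_of_ne _ _ _ _ h])
  complete := Subtype.ext (by
    ext i j
    simp [Matrix.sum_apply, Matrix.single_apply, Matrix.one_apply, ite_and])

theorem diagIdem_ne_zero (i : Fin n) : diagIdem R K α i ≠ 0 := by
  intro h
  have := congrFun (congrFun (congrArg Subtype.val h) i) i
  simp at this

theorem diagResidue_diagIdem [FaithfulSMul R K] (hα : α.IsBasic) (k i : Fin n) :
    diagResidue hα k (diagIdem R K α i) = if k = i then 1 else 0 := by
  split_ifs with h
  · subst h
    have h : diagEntry k (diagIdem R K α k) = 1 := by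
      apply FaithfulSMul.algebraMap_injective R K
      simp [algebraMap_diagEntry]
    change IsLocalRing.residue R _ = _
    rw [h, map_one]
  · rw [diagResidue_eq_zero_iff]
    simp [Ne.symm h]

theorem conj_apply (u : (order R K α)ˣ) (a : order R K α) :
    MulSemiringAction.toAlgAut (ConjAct (order R K α)ˣ) R (order R K α) (ConjAct.toConjAct u) a =
      u * a * ↑u⁻¹ := by
  simp [ConjAct.units_smul_def]

end Idempotents

/-! ### Conjugating idempotents into diagonal position. -/

section Conjugation

variable {R K : Type*} [CommRing R] [IsDomain R] [IsDiscreteValuationRing R] [Field K]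
  [Algebra R K] [IsFractionRing R K] {ϖ : R} {n : ℕ} {α : ExponentMatrix n}

theorem isUnit_of_diagResidue_ne_zero (hα : α.IsBasic) {a : order R K α}
    (ha : ∀ k, diagResidue hα k a ≠ 0) : IsUnit a := by
  obtain ⟨ϖ, hϖ⟩ := IsDiscreteValuationRing.exists_irreducible R
  exact isUnit_of_diag_notMem hϖ hα fun k h => ha k ((diagResidue_eq_zero_iff hα k a).2 h)

theorem exists_unit_conj_idempotents (hα : α.IsBasic) {f : Fin n → order R K α}
    (hf : CompleteOrthogonalIdempotents f) (hf0 : ∀ i, f i ≠ 0) :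
    ∃ (u : (order R K α)ˣ) (σ : Equiv.Perm (Fin n)),
      ∀ i, f i * u = u * diagIdem R K α (σ i) := by
  have h01 : ∀ k i, diagResidue hα k (f i) = 0 ∨ diagResidue hα k (f i) = 1 := fun k i =>
    IsIdempotentElem.iff_eq_zero_or_one.1 ((hf.idem i).map (diagResidue hα k))
  have hex : ∀ k, ∃ i, diagResidue hα k (f i) = 1 := by
    intro k
    by_contra! h
    have h1 := congrArg (diagResidue hα k) hf.complete
    rw [map_sum, Finset.sum_eq_zero fun i _ => (h01 k i).resolve_right (h i), map_one] at h1
    exact zero_ne_one h1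
  -- Residues of idempotents are `0` or `1` and add up to `1`, so each `k` is matched with some `f
  -- (τ k)`.
  choose τ hτ using hex
  have hsurj : Function.Surjective τ := by
    intro i
    by_contra! h
    have hz : ∀ k, diagResidue hα k (f i) = 0 := by
      intro k
      have := congrArg (diagResidue hα k) (hf.ortho (h k))
      simpa [hτ] using this
    -- An unmatched `f i` would make `1 - f i` a unit annihilated by `f i`, whence `f i = 0`.
    have hu : IsUnit (1 - f i) := isUnit_of_diagResidue_ne_zero hα fun k => by simp [hz]
    exact hf0 i (hu.mul_left_eq_zero.1 (hf.idem i).mul_one_sub_self)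
  have hbij : Function.Bijective τ := ⟨Finite.injective_iff_surjective.2 hsurj, hsurj⟩
  let e := Equiv.ofBijective τ hbij
  -- This sum intertwines the two families, and each of its residues is `1`.
  have hu : IsUnit (∑ k, f (τ k) * diagIdem R K α k) :=
    isUnit_of_diagResidue_ne_zero hα fun l => by
      simp [diagResidue_diagIdem, hτ]
  obtain ⟨u, hu⟩ := hu
  refine ⟨u, e.symm, fun i => ?_⟩
  obtain ⟨k, rfl⟩ := e.surjective i
  have hd := completeOrthogonalIdempotents_diagIdem R K α
  rw [hu, Finset.mul_sum, Finset.sum_mul, e.symm_apply_apply, Finset.sum_eq_single k,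
    Finset.sum_eq_single k]
  · change f (τ k) * _ = _
    rw [← mul_assoc, (hf.idem _).eq, mul_assoc, (hd.idem _).eq]
  · intro l _ hl
    rw [mul_assoc, hd.ortho hl, mul_zero]
  · simp
  · intro l _ hl
    rw [← mul_assoc]
    change f (τ k) * _ * _ = _
    rw [hf.ortho (hbij.1.ne hl.symm), zero_mul]
  · simp

end Conjugation
/-- Up to the relabelling `σ` of rows and columns, `φ` multiplies the `(i, j)` entry by
`(c i)⁻¹ * c j`. -/
def ScalesBy {R K : Type*} [CommRing R] [IsLocalRing R] [Field K] [Algebra R K] {n : ℕ}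
    {α : ExponentMatrix n} (φ : Aut R K α) (σ : Equiv.Perm (Fin n)) (c : Fin n → K) : Prop :=
  ∀ (a : order R K α) (i j : Fin n), (φ a : Matrix (Fin n) (Fin n) K) (σ i) (σ j) =
    (c i)⁻¹ * (a : Matrix (Fin n) (Fin n) K) i j * c j

/-! ### Conjugation by monomial matrices. -/

section DiagPow

variable {R K : Type*} [CommRing R] [Field K] [Algebra R K] {ϖ : R} {n : ℕ}

theorem isUnit_diagPow_mul_permMatrix [FaithfulSMul R K] (hϖ : Irreducible ϖ) (x : Fin n → ℤ)
    (σ : Equiv.Perm (Fin n)) : IsUnit (diagPow K ϖ x * Equiv.Perm.permMatrix K σ) := by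
  have h0 := algebraMap_irreducible_ne_zero (K := K) hϖ
  rw [Matrix.isUnit_iff_isUnit_det, Matrix.det_mul, diagPow, Matrix.det_diagonal,
    Matrix.det_permutation, isUnit_iff_ne_zero]
  refine mul_ne_zero (Finset.prod_ne_zero_iff.2 fun i _ => zpow_ne_zero _ h0) ?_
  rcases Int.units_eq_one_or (Equiv.Perm.sign σ) with h | h <;> simp [h]

theorem diagPow_mul_permMatrix_mul_apply (x : Fin n → ℤ) (σ : Equiv.Perm (Fin n))
    (B : Matrix (Fin n) (Fin n) K) (i j : Fin n) :
    (diagPow K ϖ x * Equiv.Perm.permMatrix K σ * B) i j =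
      algebraMap R K ϖ ^ x i * B (σ i) j := by
  rw [diagPow, mul_assoc, PEquiv.toMatrix_toPEquiv_mul, Matrix.diagonal_mul]
  rfl

theorem mul_diagPow_mul_permMatrix_apply (x : Fin n → ℤ) (σ : Equiv.Perm (Fin n))
    (A : Matrix (Fin n) (Fin n) K) (i j : Fin n) :
    (A * (diagPow K ϖ x * Equiv.Perm.permMatrix K σ)) i (σ j) =
      A i j * algebraMap R K ϖ ^ x j := by
  rw [diagPow, ← mul_assoc, PEquiv.mul_toMatrix_toPEquiv, Matrix.submatrix_apply,
    Equiv.symm_apply_apply, Matrix.mul_diagonal]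
  rfl

theorem eq_conj_diagPow_iff [FaithfulSMul R K] (hϖ : Irreducible ϖ) (x : Fin n → ℤ) (σ : Equiv.Perm (Fin n))
    (A B : Matrix (Fin n) (Fin n) K) :
    B = (diagPow K ϖ x * Equiv.Perm.permMatrix K σ)⁻¹ * A *
        (diagPow K ϖ x * Equiv.Perm.permMatrix K σ) ↔
      ∀ i j, B (σ i) (σ j) = (algebraMap R K ϖ ^ x i)⁻¹ * A i j * algebraMap R K ϖ ^ x j := by
  have h0 := algebraMap_irreducible_ne_zero (K := K) hϖ
  have hu := (Matrix.isUnit_iff_isUnit_det _).1 (isUnit_diagPow_mul_permMatrix (K := K) hϖ x σ)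
  have hcancel : B = (diagPow K ϖ x * Equiv.Perm.permMatrix K σ)⁻¹ * A *
        (diagPow K ϖ x * Equiv.Perm.permMatrix K σ) ↔
      diagPow K ϖ x * Equiv.Perm.permMatrix K σ * B =
        A * (diagPow K ϖ x * Equiv.Perm.permMatrix K σ) := by
    constructor
    · rintro rfl
      rw [mul_assoc _ A, Matrix.mul_nonsing_inv_cancel_left _ _ hu]
    · intro h
      rw [mul_assoc _ A, ← h, Matrix.nonsing_inv_mul_cancel_left _ _ hu]
  rw [hcancel, ← Matrix.ext_iff]
  refine forall_congr' fun i => ?_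
  rw [← σ.forall_congr_right]
  refine forall_congr' fun j => ?_
  rw [diagPow_mul_permMatrix_mul_apply, mul_diagPow_mul_permMatrix_apply, mul_assoc,
    eq_inv_mul_iff_mul_eq₀ (zpow_ne_zero _ h0)]

end DiagPow

/-! ### Reduction to monomial automorphisms; the linear system. -/

section

variable {R K : Type*} [CommRing R] [IsDomain R] [IsDiscreteValuationRing R] [Field K]
  [Algebra R K] [IsFractionRing R K] {ϖ : R} {n : ℕ} {α : ExponentMatrix n}

theorem pow_mem_primePow (hϖ : Irreducible ϖ) (a : ℕ) :
    algebraMap R K ϖ ^ a ∈ primePow R K a := by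
  rw [← zpow_natCast]
  exact (zpow_mem_primePow_iff hϖ).2 le_rfl

/-- The generator `ϖ ^ α i j` of the order in position `(i, j)`. -/
def orderGen (hϖ : Irreducible ϖ) (i j : Fin n) : order R K α :=
  orderSingle α i j ⟨_, pow_mem_primePow hϖ (α.exp i j)⟩

@[simp]
theorem coe_orderGen (hϖ : Irreducible ϖ) (i j : Fin n) :
    (orderGen hϖ i j : order R K α).1 = Matrix.single i j (algebraMap R K ϖ ^ α.exp i j) := rfl

/-- The corner `e_i * a * e_j` is an `R`-multiple of the generator in position `(i, j)`, so
`R`-linearity makes the scaling factor independent of `a`. -/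
theorem apply_entry_of_map_diagIdem (hϖ : Irreducible ϖ) {ψ : Aut R K α}
    {σ : Equiv.Perm (Fin n)} (hψ : ∀ i, ψ (diagIdem R K α i) = diagIdem R K α (σ i))
    (a : order R K α) (i j : Fin n) :
    (ψ a).1 (σ i) (σ j) =
      a.1 i j * ((ψ (orderGen hϖ i j)).1 (σ i) (σ j) / algebraMap R K ϖ ^ α.exp i j) := by
  have h0 := algebraMap_irreducible_ne_zero (K := K) hϖ
  obtain ⟨r, hr⟩ := (mem_primePow_iff hϖ).1 (a.2 i j)
  have h1 : diagIdem R K α i * a * diagIdem R K α j = r • orderGen hϖ i j := by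
    apply Subtype.ext
    simp [hr, Matrix.single_mul_mul_single, Matrix.smul_single]
    rw [Algebra.smul_def, mul_comm]
  have h2 := congrArg (fun b => (ψ b).1 (σ i) (σ j)) h1
  simp only [map_mul, map_smul, hψ] at h2
  simp only [MulMemClass.coe_mul, coe_diagIdem, Matrix.single_mul_mul_single, one_mul, mul_one,
    Matrix.single_apply_same, SetLike.val_smul, Matrix.smul_apply] at h2
  rw [h2, hr, Algebra.smul_def]
  field_simp

theorem exists_scalesBy_of_map_diagIdem {ψ : Aut R K α}
    {σ : Equiv.Perm (Fin n)} (hψ : ∀ i, ψ (diagIdem R K α i) = diagIdem R K α (σ i)) :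
    ∃ c : Fin n → K, (∀ i, c i ≠ 0) ∧ ScalesBy ψ σ c := by
  obtain ⟨ϖ, hϖ⟩ := IsDiscreteValuationRing.exists_irreducible R
  have h0 := algebraMap_irreducible_ne_zero (K := K) hϖ
  rcases isEmpty_or_nonempty (Fin n) with hn | ⟨⟨o⟩⟩
  · exact ⟨fun _ => 0, fun i => isEmptyElim i, fun _ i => isEmptyElim i⟩
  set h : Fin n → Fin n → K := fun i j =>
    (ψ (orderGen hϖ i j)).1 (σ i) (σ j) / algebraMap R K ϖ ^ α.exp i j with hh
  have key : ∀ (a : order R K α) i j, (ψ a).1 (σ i) (σ j) = a.1 i j * h i j :=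
    apply_entry_of_map_diagIdem hϖ hψ
  have hone : ∀ i, h i i = 1 := fun i => by simpa using (key 1 i i).symm
  have hmul : ∀ i j k, h i j * h j k = h i k := by
    intro i j k
    have h1 := key (orderGen hϖ i j * orderGen hϖ j k) i k
    rw [map_mul, MulMemClass.coe_mul, Matrix.mul_apply, ← Equiv.sum_comp σ] at h1
    simp only [key, MulMemClass.coe_mul, coe_orderGen, Matrix.single_mul_single_same,
      Matrix.single_apply_same] at h1
    rw [Finset.sum_eq_single j, Matrix.single_apply_same, Matrix.single_apply_same] at h1
    · have h2 := mul_ne_zero (pow_ne_zero (α.exp i j) h0) (pow_ne_zero (α.exp j k) h0)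
      refine mul_left_cancel₀ h2 ?_
      rw [← h1]
      ring
    · intro l _ hl
      simp [hl.symm]
    · simp
  have hne : ∀ i, h o i * h i o = 1 := fun i => by rw [hmul, hone]
  -- The cocycle is split through the base point `o`: `h i j = h i o * h o j`.
  refine ⟨h o, fun i => left_ne_zero_of_mul_eq_one (hne i), fun a i j => ?_⟩
  rw [key, ← hmul i o j, eq_inv_of_mul_eq_one_right (hne i)]
  ring

/-- The diagonal matrix with given units of `R` as diagonal entries, as a unit of the order. -/
def diagUnit (α : ExponentMatrix n) (w : Fin n → Rˣ) : (order R K α)ˣ where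
  val := ⟨Matrix.diagonal fun i => algebraMap R K (w i), fun i j => by
    by_cases h : i = j
    · subst h
      rw [Matrix.diagonal_apply_eq, α.diag]
      exact mem_primePow_zero.2 ⟨_, rfl⟩
    · rw [Matrix.diagonal_apply_ne _ h]
      exact zero_mem _⟩
  inv := ⟨Matrix.diagonal fun i => algebraMap R K ↑(w i)⁻¹, fun i j => by
    by_cases h : i = j
    · subst h
      rw [Matrix.diagonal_apply_eq, α.diag]
      exact mem_primePow_zero.2 ⟨_, rfl⟩
    · rw [Matrix.diagonal_apply_ne _ h]
      exact zero_mem _⟩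
  val_inv := Subtype.ext (by simp)
  inv_val := Subtype.ext (by simp)

theorem exists_inn_mul_scalesBy (hϖ : Irreducible ϖ) (hα : α.IsBasic) (φ : Aut R K α) :
    ∃ ι ∈ inn R K α, ∃ (θ : Aut R K α) (σ : Equiv.Perm (Fin n)) (x : Fin n → ℤ),
      ScalesBy θ σ (fun i => algebraMap R K ϖ ^ x i) ∧ φ = ι * θ := by
  have h0 := algebraMap_irreducible_ne_zero (K := K) hϖ
  obtain ⟨u, σ, hu⟩ := exists_unit_conj_idempotents hα
    ((completeOrthogonalIdempotents_diagIdem R K α).map (φ : order R K α →+* order R K α))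
    (fun i => (map_ne_zero_iff _ φ.injective).2 (diagIdem_ne_zero i))
  let conj := MulSemiringAction.toAlgAut (ConjAct (order R K α)ˣ) R (order R K α)
  have hψ : ∀ i, (conj (ConjAct.toConjAct u⁻¹) * φ) (diagIdem R K α i) =
      diagIdem R K α (σ i) := by
    intro i
    rw [AlgEquiv.mul_apply, conj_apply, inv_inv, mul_assoc, Units.inv_mul_eq_iff_eq_mul]
    exact hu i
  obtain ⟨c, hc, hs⟩ := exists_scalesBy_of_map_diagIdem hψ
  choose x w hxw using fun i => exists_eq_zpow_mul_unit hϖ (hc i)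
  -- The factor `c i` acts at row `σ i`, hence the reindexing by `σ.symm`.
  let v : (order R K α)ˣ := diagUnit α (w ∘ σ.symm)
  refine ⟨(conj (ConjAct.toConjAct v) * conj (ConjAct.toConjAct u⁻¹))⁻¹,
    inv_mem (mul_mem ⟨_, rfl⟩ ⟨_, rfl⟩),
    conj (ConjAct.toConjAct v) * (conj (ConjAct.toConjAct u⁻¹) * φ), σ, x, ?_, ?_⟩
  · intro a i j
    have hi : algebraMap R K (w i) ≠ 0 := by simp
    have hj : algebraMap R K ↑(w j)⁻¹ = (algebraMap R K (w j))⁻¹ :=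
      eq_inv_of_mul_eq_one_left (by rw [← map_mul, Units.inv_mul, map_one])
    have hj' : algebraMap R K (w j) ≠ 0 := by simp
    rw [AlgEquiv.mul_apply, conj_apply, MulMemClass.coe_mul, MulMemClass.coe_mul]
    change (Matrix.diagonal _ * _ * Matrix.diagonal _ : Matrix (Fin n) (Fin n) K) _ _ = _
    rw [Matrix.mul_diagonal, Matrix.diagonal_mul, hs a i j, hxw i, hxw j]
    simp only [Function.comp_apply, Equiv.symm_apply_apply, hj]
    field_simp
  · group

/-- The image of a generator under `φ` lies in the order, which gives one inequality; the preimage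
of a generator gives the reverse one. -/
theorem solves_of_scalesBy (hϖ : Irreducible ϖ) {φ : Aut R K α} {σ : Equiv.Perm (Fin n)}
    {x : Fin n → ℤ} (h : ScalesBy φ σ (fun i => algebraMap R K ϖ ^ x i)) : Solves α σ x := by
  have h0 := algebraMap_irreducible_ne_zero (K := K) hϖ
  intro i j
  have h1 : (α.exp (σ i) (σ j) : ℤ) ≤ -x i + α.exp i j + x j := by
    have := (φ (orderGen hϖ i j)).2 (σ i) (σ j)
    rw [h, coe_orderGen, Matrix.single_apply_same, ← zpow_natCast, ← zpow_neg,
      ← zpow_add₀ h0, ← zpow_add₀ h0] at this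
    exact (zpow_mem_primePow_iff hϖ).1 this
  have h2 : (α.exp i j : ℤ) ≤ x i + α.exp (σ i) (σ j) + -x j := by
    have h3 := h (φ.symm (orderGen hϖ (σ i) (σ j))) i j
    rw [AlgEquiv.apply_symm_apply, coe_orderGen, Matrix.single_apply_same] at h3
    have h4 := (φ.symm (orderGen hϖ (σ i) (σ j))).2 i j
    have h5 : (φ.symm (orderGen hϖ (σ i) (σ j))).1 i j =
        algebraMap R K ϖ ^ (x i + α.exp (σ i) (σ j) + -x j) := by
      rw [zpow_add₀ h0, zpow_add₀ h0, zpow_neg, zpow_natCast, h3]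
      have := zpow_ne_zero (x i) h0
      have := zpow_ne_zero (x j) h0
      field_simp
    rw [h5] at h4
    exact (zpow_mem_primePow_iff hϖ).1 h4
  omega

theorem isConjBy_diagPow_iff (hϖ : Irreducible ϖ) {φ : Aut R K α} {σ : Equiv.Perm (Fin n)}
    {x : Fin n → ℤ} : IsConjBy φ (diagPow K ϖ x * Equiv.Perm.permMatrix K σ) ↔
      ScalesBy φ σ (fun i => algebraMap R K ϖ ^ x i) := by
  simp only [IsConjBy, ScalesBy, eq_conj_diagPow_iff hϖ]
  exact and_iff_right (isUnit_diagPow_mul_permMatrix hϖ x σ)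

theorem zpow_mul_mem_primePow (hϖ : Irreducible ϖ) {a b : ℕ} {z : ℤ} (hz : (b : ℤ) ≤ z + a)
    {y : K} (hy : y ∈ primePow R K a) : algebraMap R K ϖ ^ z * y ∈ primePow R K b := by
  have h0 := algebraMap_irreducible_ne_zero (K := K) hϖ
  obtain ⟨r, rfl⟩ := (mem_primePow_iff hϖ).1 hy
  rw [← mul_assoc, ← zpow_natCast, ← zpow_add₀ h0]
  exact primePow_mul_mem (b := 0) le_rfl ((zpow_mem_primePow_iff hϖ).2 hz)
    (mem_primePow_zero.2 ⟨r, rfl⟩)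

theorem exists_isConjBy_of_solves (hϖ : Irreducible ϖ) {σ : Equiv.Perm (Fin n)}
    {x : Fin n → ℤ} (h : Solves α σ x) :
    ∃ φ : Aut R K α, IsConjBy φ (diagPow K ϖ x * Equiv.Perm.permMatrix K σ) := by
  have h0 := algebraMap_irreducible_ne_zero (K := K) hϖ
  obtain ⟨g, hg⟩ := isUnit_diagPow_mul_permMatrix (K := K) hϖ x σ
  let e : Matrix (Fin n) (Fin n) K ≃ₐ[R] Matrix (Fin n) (Fin n) K :=
    MulSemiringAction.toAlgAut (ConjAct (Matrix (Fin n) (Fin n) K)ˣ) R _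
      (ConjAct.toConjAct g⁻¹)
  have he : ∀ A, e A = (diagPow K ϖ x * Equiv.Perm.permMatrix K σ)⁻¹ * A *
      (diagPow K ϖ x * Equiv.Perm.permMatrix K σ) := by
    intro A
    simp [e, ConjAct.units_smul_def, ← hg, Matrix.coe_units_inv]
  -- The system says that the exponent shift `x j - x i` carries `P ^ α i j` exactly onto `P ^ α (σ
  -- i) (σ j)`.
  have hmem : ∀ A, e A ∈ order R K α ↔ A ∈ order R K α := by
    intro A
    have hent := (eq_conj_diagPow_iff hϖ x σ A (e A)).1 (he A)
    constructor
    · intro hA i j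
      have h1 := hA (σ i) (σ j)
      have h2 : A i j = algebraMap R K ϖ ^ (x i - x j) * e A (σ i) (σ j) := by
        have := zpow_ne_zero (x i) h0
        have := zpow_ne_zero (x j) h0
        rw [hent, zpow_sub₀ h0]
        field_simp
      rw [h2]
      exact zpow_mul_mem_primePow hϖ (by have := h i j; omega) h1
    · intro hA k l
      obtain ⟨i, rfl⟩ := σ.surjective k
      obtain ⟨j, rfl⟩ := σ.surjective l
      have h2 : e A (σ i) (σ j) = algebraMap R K ϖ ^ (x j - x i) * A i j := by
        rw [hent, zpow_sub₀ h0]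
        ring
      rw [h2]
      exact zpow_mul_mem_primePow hϖ (by have := h i j; omega) (hA i j)
  have hmap : (order R K α).map (e : Matrix (Fin n) (Fin n) K →ₐ[R] _) = order R K α := by
    ext B
    rw [Subalgebra.mem_map]
    constructor
    · rintro ⟨A, hA, rfl⟩
      exact (hmem A).2 hA
    · intro hB
      exact ⟨e.symm B, (hmem _).1 (by simpa using hB), by simp⟩
  exact ⟨(e.subalgebraMap (order R K α)).trans (Subalgebra.equivOfEq _ _ hmap),
    isUnit_diagPow_mul_permMatrix hϖ x σ, fun a => he a⟩

end
-- Induced permutations and the link graph.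
section Induces

variable {R K : Type*} [CommRing R] [IsLocalRing R] [Field K] [Algebra R K] {n : ℕ}
  {α : ExponentMatrix n}

theorem Induces.mul {φ ψ : Aut R K α} {σ τ : Equiv.Perm (Fin n)} (hφ : Induces φ σ)
    (hψ : Induces ψ τ) : Induces (φ * ψ) (σ * τ) := fun i a =>
  (hφ (τ i) (ψ a)).trans (hψ i a)

variable (R K α) in
/-- `M_k` as a submodule of the order. -/
def maxIdealIn (k : Fin n) : Submodule R (order R K α) :=
  (maxIdeal R K α k).comap (order R K α).val.toLinearMap

theorem maxIdeal_le_order (k : Fin n) :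
    maxIdeal R K α k ≤ Subalgebra.toSubmodule (order R K α) := by
  intro A hA i j
  have h := hA i j
  dsimp only at h
  split_ifs at h with hij
  · obtain ⟨rfl, rfl⟩ := hij
    rw [α.diag]
    exact primePow_anti zero_le_one h
  · exact h

theorem map_maxIdealIn (k : Fin n) :
    (maxIdealIn R K α k).map (order R K α).val.toLinearMap = maxIdeal R K α k := by
  rw [maxIdealIn, Submodule.map_comap_eq, inf_eq_right]
  intro A hA
  exact ⟨⟨A, maxIdeal_le_order k hA⟩, rfl⟩

/-- An automorphism acts only on the order, so products and intersections must be formed there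
before they can be transported. -/
theorem linkArrow_iff (i j : Fin n) : LinkArrow R K α i j ↔
    maxIdealIn R K α j * maxIdealIn R K α i ≠ maxIdealIn R K α j ⊓ maxIdealIn R K α i := by
  have hinj : Function.Injective (order R K α).val.toLinearMap := Subtype.val_injective
  rw [LinkArrow, ← map_maxIdealIn i, ← map_maxIdealIn j, ← Submodule.map_mul,
    ← Submodule.map_inf _ hinj, (Submodule.map_injective_of_injective hinj).ne_iff]

theorem Induces.map_maxIdealIn {φ : Aut R K α} {σ : Equiv.Perm (Fin n)} (h : Induces φ σ)
    (k : Fin n) : (maxIdealIn R K α k).map (φ : order R K α →ₐ[R] order R K α).toLinearMap =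
      maxIdealIn R K α (σ k) := by
  ext a
  constructor
  · rintro ⟨b, hb, rfl⟩
    exact (h k b).2 hb
  · intro ha
    refine ⟨φ.symm a, (h k _).1 ?_, φ.apply_symm_apply a⟩
    rwa [AlgEquiv.apply_symm_apply]

theorem Induces.linkArrow_iff {φ : Aut R K α} {σ : Equiv.Perm (Fin n)} (h : Induces φ σ)
    (i j : Fin n) : LinkArrow R K α (σ i) (σ j) ↔ LinkArrow R K α i j := by
  have hinj : Function.Injective (φ : order R K α →ₐ[R] order R K α).toLinearMap := φ.injective
  rw [TiledOrder.linkArrow_iff, TiledOrder.linkArrow_iff, ← h.map_maxIdealIn,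
    ← h.map_maxIdealIn, ← Submodule.map_mul, ← Submodule.map_inf _ hinj,
    (Submodule.map_injective_of_injective hinj).ne_iff]

/-- The automorphism of the link graph given by the permutation that `φ` induces. -/
def Induces.linkAut {φ : Aut R K α} {σ : Equiv.Perm (Fin n)} (h : Induces φ σ) :
    LinkAut R K α :=
  ⟨σ, h.linkArrow_iff _ _⟩

theorem inn_normal (α : ExponentMatrix n) : (inn R K α).Normal := by
  refine ⟨fun ι hι φ => ?_⟩
  obtain ⟨u, rfl⟩ := hι
  obtain ⟨u, rfl⟩ := ConjAct.toConjAct.surjective u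
  refine ⟨ConjAct.toConjAct (Units.map (φ : order R K α →* order R K α) u), ?_⟩
  ext1 a
  rw [conj_apply, AlgEquiv.mul_apply, AlgEquiv.mul_apply, conj_apply, map_mul, map_mul,
    AlgEquiv.aut_inv, AlgEquiv.apply_symm_apply]
  rfl

variable [FaithfulSMul R K]

theorem ScalesBy.induces (hα : α.IsBasic) {φ : Aut R K α} {σ : Equiv.Perm (Fin n)}
    {c : Fin n → K} (h : ScalesBy φ σ c) (hc : ∀ i, c i ≠ 0) : Induces φ σ := by
  intro i a
  rw [mem_maxIdeal_iff hα, mem_maxIdeal_iff hα, diagResidue_eq_zero_iff,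
    diagResidue_eq_zero_iff, h a i i, mul_right_comm, inv_mul_cancel₀ (hc i), one_mul]

theorem induces_one_of_mem_inn (hα : α.IsBasic) {φ : Aut R K α} (h : φ ∈ inn R K α) :
    Induces φ 1 := by
  obtain ⟨u, rfl⟩ := h
  obtain ⟨u, rfl⟩ := ConjAct.toConjAct.surjective u
  intro i a
  rw [mem_maxIdeal_iff hα, mem_maxIdeal_iff hα, conj_apply, Equiv.Perm.one_apply]
  rw [map_mul, map_mul, mul_right_comm, ← map_mul, Units.mul_inv, map_one, one_mul]

/-- The idempotent `e_k` lies in every `M_l` except `M_k`, so it separates the ideals. -/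
theorem Induces.unique (hα : α.IsBasic) {φ : Aut R K α} {σ τ : Equiv.Perm (Fin n)}
    (hσ : Induces φ σ) (hτ : Induces φ τ) : σ = τ := by
  ext1 i
  have h := (hσ i (φ.symm (diagIdem R K α (σ i)))).trans (hτ i _).symm
  rw [AlgEquiv.apply_symm_apply, mem_maxIdeal_iff hα, mem_maxIdeal_iff hα,
    diagResidue_diagIdem, diagResidue_diagIdem, if_pos rfl] at h
  by_contra hne
  rw [if_neg (Ne.symm hne)] at h
  exact one_ne_zero (h.2 rfl)

end Induces

section ScalesBy

variable {R K : Type*} [CommRing R] [IsLocalRing R] [Field K] [Algebra R K] {n : ℕ}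
  {α : ExponentMatrix n}

theorem ScalesBy.one (p : K) (hp : p ≠ 0) : ScalesBy (1 : Aut R K α) 1 fun _ => p := by
  intro a i j
  rw [mul_right_comm, inv_mul_cancel₀ hp, one_mul]
  rfl

theorem ScalesBy.mul {φ ψ : Aut R K α} {σ τ : Equiv.Perm (Fin n)} {c d : Fin n → K}
    (hφ : ScalesBy φ σ c) (hψ : ScalesBy ψ τ d) :
    ScalesBy (φ * ψ) (σ * τ) fun i => d i * c (τ i) := by
  intro a i j
  rw [AlgEquiv.mul_apply, Equiv.Perm.mul_apply, Equiv.Perm.mul_apply, hφ, hψ, mul_inv]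
  ring

theorem ScalesBy.inv {φ : Aut R K α} {σ : Equiv.Perm (Fin n)} {c : Fin n → K}
    (hφ : ScalesBy φ σ c) (hc : ∀ i, c i ≠ 0) : ScalesBy φ⁻¹ σ⁻¹ fun i => (c (σ⁻¹ i))⁻¹ := by
  intro a i j
  have h := hφ (φ⁻¹ a) (σ⁻¹ i) (σ⁻¹ j)
  simp only [AlgEquiv.aut_inv, AlgEquiv.apply_symm_apply, Equiv.Perm.inv_def,
    Equiv.apply_symm_apply] at h
  have hi := hc (σ⁻¹ i)
  have hj := hc (σ⁻¹ j)
  simp only [AlgEquiv.aut_inv, Equiv.Perm.inv_def, h] at *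
  field_simp

theorem ScalesBy.eq_one {φ : Aut R K α} {c : Fin n → K} (h : ScalesBy φ 1 c)
    (hc : ∀ i, c i ≠ 0) (hconst : ∀ i j, c i = c j) : φ = 1 := by
  ext1 a
  apply Subtype.ext
  ext i j
  have := h a i j
  rw [hconst i j, mul_right_comm, inv_mul_cancel₀ (hc j), one_mul] at this
  exact this

end ScalesBy

/-! ### Liftability and the semidirect decomposition. -/

section Main

variable {R K : Type*} [CommRing R] [IsDomain R] [IsDiscreteValuationRing R] [Field K]
  [Algebra R K] [IsFractionRing R K] {ϖ : R} {n : ℕ} {α : ExponentMatrix n}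

theorem exists_solves_of_induces (hα : α.IsBasic) {φ : Aut R K α}
    {σ : Equiv.Perm (Fin n)} (h : Induces φ σ) : ∃ x, Solves α σ x := by
  obtain ⟨ϖ, hϖ⟩ := IsDiscreteValuationRing.exists_irreducible R
  have h0 := algebraMap_irreducible_ne_zero (K := K) hϖ
  obtain ⟨ι, hι, θ, τ, x, hθ, rfl⟩ := exists_inn_mul_scalesBy hϖ hα φ
  have h1 := (induces_one_of_mem_inn hα hι).mul (hθ.induces hα fun i => zpow_ne_zero _ h0)
  rw [one_mul] at h1
  exact ⟨x, h.unique hα h1 ▸ solves_of_scalesBy hϖ hθ⟩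

theorem liftable_of_solves (hα : α.IsBasic) {σ : LinkAut R K α} {x : Fin n → ℤ}
    (h : Solves α σ.toEquiv x) : Liftable σ := by
  obtain ⟨ϖ, hϖ⟩ := IsDiscreteValuationRing.exists_irreducible R
  have h0 := algebraMap_irreducible_ne_zero (K := K) hϖ
  obtain ⟨φ, hφ⟩ := exists_isConjBy_of_solves (K := K) hϖ h
  exact ⟨φ, ((isConjBy_diagPow_iff hϖ).1 hφ).induces hα fun i => zpow_ne_zero _ h0⟩

/-- For a monomial automorphism, liftability, the link graph condition and the linear system are
automatic; closure under products and inverses can then be checked on scaling factors alone. -/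
theorem mem_liftSet_iff (hϖ : Irreducible ϖ) (hα : α.IsBasic) {φ : Aut R K α} :
    φ ∈ liftSet K ϖ α ↔ ∃ (σ : Equiv.Perm (Fin n)) (x : Fin n → ℤ),
      ScalesBy φ σ (fun i => algebraMap R K ϖ ^ x i) := by
  have h0 := algebraMap_irreducible_ne_zero (K := K) hϖ
  constructor
  · rintro ⟨σ, -, x, -, h⟩
    exact ⟨σ.toEquiv, x, (isConjBy_diagPow_iff hϖ).1 h⟩
  · rintro ⟨σ, x, h⟩
    have hi := h.induces hα fun i => zpow_ne_zero _ h0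
    exact ⟨hi.linkAut, ⟨φ, hi⟩, x, solves_of_scalesBy hϖ h, (isConjBy_diagPow_iff hϖ).2 h⟩

/-- The subgroup `O_Λ` of `Aut_R(Λ)`. -/
def liftSubgroup (K : Type*) [Field K] [Algebra R K] [IsFractionRing R K] (hϖ : Irreducible ϖ)
    (hα : α.IsBasic) : Subgroup (Aut R K α) where
  carrier := liftSet K ϖ α
  one_mem' := (mem_liftSet_iff hϖ hα).2
    ⟨1, 0, by simpa using ScalesBy.one (1 : K) one_ne_zero⟩
  mul_mem' := by
    intro φ ψ hφ hψ
    obtain ⟨σ, x, h⟩ := (mem_liftSet_iff hϖ hα).1 hφ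
    obtain ⟨τ, y, h'⟩ := (mem_liftSet_iff hϖ hα).1 hψ
    have h0 := algebraMap_irreducible_ne_zero (K := K) hϖ
    refine (mem_liftSet_iff hϖ hα).2 ⟨σ * τ, fun i => y i + x (τ i), ?_⟩
    simpa only [zpow_add₀ h0] using h.mul h'
  inv_mem' := by
    intro φ hφ
    obtain ⟨σ, x, h⟩ := (mem_liftSet_iff hϖ hα).1 hφ
    have h0 := algebraMap_irreducible_ne_zero (K := K) hϖ
    refine (mem_liftSet_iff hϖ hα).2 ⟨σ⁻¹, fun i => -x (σ⁻¹ i), ?_⟩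
    simpa only [zpow_neg] using h.inv fun i => zpow_ne_zero _ h0

theorem isComplement'_inn_liftSubgroup (hϖ : Irreducible ϖ) (hα : α.IsBasic) :
    (inn R K α).IsComplement' (liftSubgroup K hϖ hα) := by
  have h0 := algebraMap_irreducible_ne_zero (K := K) hϖ
  refine Subgroup.isComplement'_of_disjoint_and_mul_eq_univ ?_ ?_
  · rw [Subgroup.disjoint_def]
    intro φ hφ hφ'
    obtain ⟨σ, x, h⟩ := (mem_liftSet_iff hϖ hα).1 hφ'
    obtain rfl := (h.induces hα fun i => zpow_ne_zero _ h0).unique hα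
      (induces_one_of_mem_inn hα hφ)
    -- With trivial permutation the system makes `x` constant, so the conjugating matrix is scalar.
    have hs := solves_of_scalesBy hϖ h
    refine h.eq_one (fun i => zpow_ne_zero _ h0) fun i j => ?_
    have := hs i j
    simp only [Equiv.Perm.one_apply, sub_self, sub_eq_zero] at this
    rw [this]
  · refine Set.eq_univ_of_forall fun φ => ?_
    obtain ⟨ι, hι, θ, σ, x, hθ, rfl⟩ := exists_inn_mul_scalesBy hϖ hα φ
    exact Set.mul_mem_mul hι ((mem_liftSet_iff hϖ hα).2 ⟨σ, x, hθ⟩)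

theorem solves_of_isConjBy_unit_mul (hϖ : Irreducible ϖ) {φ : Aut R K α} {u : (order R K α)ˣ}
    {d : Fin n → ℤ} {σ : Equiv.Perm (Fin n)}
    (h : IsConjBy φ ((u : order R K α) * diagPow K ϖ d * Equiv.Perm.permMatrix K σ)) :
    Solves α σ d := by
  let conj := MulSemiringAction.toAlgAut (ConjAct (order R K α)ˣ) R (order R K α)
  have huv : (u : order R K α).1 * (↑u⁻¹ : order R K α).1 = 1 := congrArg Subtype.val u.mul_inv
  have hvu : (↑u⁻¹ : order R K α).1 * (u : order R K α).1 = 1 := congrArg Subtype.val u.inv_mul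
  -- Precomposing with `a ↦ u * a * u⁻¹` cancels the factor `u`.
  refine solves_of_scalesBy hϖ (φ := φ * conj (ConjAct.toConjAct u))
    ((isConjBy_diagPow_iff hϖ).1 ⟨isUnit_diagPow_mul_permMatrix hϖ d σ, fun a => ?_⟩)
  rw [AlgEquiv.mul_apply, conj_apply, h.2, mul_assoc (u : order R K α).1, Matrix.mul_inv_rev,
    Matrix.inv_eq_left_inv hvu]
  simp only [MulMemClass.coe_mul, mul_assoc]
  rw [← mul_assoc (↑u⁻¹ : order R K α).1 (u : order R K α).1, hvu, one_mul,
    ← mul_assoc (↑u⁻¹ : order R K α).1 (u : order R K α).1, hvu, one_mul]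

end Main

end TiledOrder

theorem theorem5 {R K : Type*} [CommRing R] [IsDomain R] [IsDiscreteValuationRing R]
    [IsAdicComplete (IsLocalRing.maximalIdeal R) R]
    [Field K] [Algebra R K] [IsFractionRing R K]
    (ϖ : R) (hϖ : Irreducible ϖ) {n : ℕ} (α : ExponentMatrix n) (hα : α.IsBasic) :
    -- (a)
    (∀ σ : LinkAut R K α, Liftable σ ↔ ∃ x : Fin n → ℤ, Solves α σ.toEquiv x) ∧
    -- (b), needing only the equations with i < j
    (∀ σ : LinkAut R K α, Liftable σ → ∀ x : Fin n → ℤ,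
      (∀ i j, i < j →
        x i - x j = (α.exp i j : ℤ) - (α.exp (σ.toEquiv i) (σ.toEquiv j) : ℤ)) →
      ∃ φ : Aut R K α, IsConjBy φ (diagPow K ϖ x * Equiv.Perm.permMatrix K σ.toEquiv)) ∧
    -- (c)
    (∀ (φ : Aut R K α) (u : (order R K α)ˣ) (d : Fin n → ℤ) (σ : Equiv.Perm (Fin n)),
      IsConjBy φ ((u : order R K α) * diagPow K ϖ d * Equiv.Perm.permMatrix K σ) → Solves α σ d) ∧
    -- (d)
    (∃ O : Subgroup (Aut R K α), (O : Set (Aut R K α)) = liftSet K ϖ α ∧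
      (inn R K α).Normal ∧ (inn R K α).IsComplement' O) := by
  have hsolve : ∀ σ : LinkAut R K α, Liftable σ → ∃ x : Fin n → ℤ, Solves α σ.toEquiv x :=
    fun σ ⟨_, hφ⟩ => exists_solves_of_induces hα hφ
  refine ⟨fun σ => ⟨hsolve σ, fun ⟨_, hx⟩ => liftable_of_solves hα hx⟩, fun σ hσ x hx => ?_,
    fun φ u d σ h => solves_of_isConjBy_unit_mul hϖ h,
    liftSubgroup K hϖ hα, rfl, inn_normal α, isComplement'_inn_liftSubgroup hϖ hα⟩
  -- Adding the equations of a full solution `y` at `(i, j)` and `(j, i)` shows that `σ` preserves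
  -- `α i j + α j i`; hence the equation for `x` at `(j, i)` implies the one at `(i, j)`.
  obtain ⟨y, hy⟩ := hsolve σ hσ
  refine exists_isConjBy_of_solves hϖ fun i j => ?_
  have hij := hy i j
  have hji := hy j i
  rcases lt_trichotomy i j with h | rfl | h
  · exact hx i j h
  · omega
  · have := hx j i h
    omega
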